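/- All vector spaces are over $\mathbb{C}$. Let $(\mathcal{L},[\cdot_\lambda\cdot])$ be a Lie conformal algebra: a $\mathbb{C}[\partial]$-module with a bilinear bracket $[p_\lambda q]\in\mathcal{L}[\lambda]$ such that $[\partial p_\lambda q]=-\lambda[p_\lambda q]$, $[p_\lambda \partial q]=(\partial+\lambda)[p_\lambda q]$, $[p_\lambda q]=-[q_{-\partial-\lambda}p]$ and $[p_\lambda[q_\mu r]]=[[p_\lambda q]_{\lambda+\mu}r]+[q_\mu[p_\lambda r]]$. Let $\mathcal{N}$ be a Nijenhuis operator on it, that is, a $\mathbb{C}[\partial]$-linear map $\mathcal{N}:\mathcal{L}\to\mathcal{L}$ with $$[\mathcal{N}(p)_\lambda \mathcal{N}(q)]=\mathcal{N}\big([p_\lambda q]_{\mathcal{N}}\big),\qquad [p_\lambda q]_{\mathcal{N}}:=[\mathcal{N}(p)_\lambda q]+[p_\lambda \mathcal{N}(q)]-\mathcal{N}([p_\lambda q]).$$ *Cohomology.* Let $C^1(\mathcal{L},\mathcal{L})$ be the space of $\mathbb{C}[\partial]$-linear maps $\mathcal{L}\to\mathcal{L}$, and $C^2(\mathcal{L},\mathcal{L})$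 the space of bilinear maps $f_\lambda:\mathcal{L}\times\mathcal{L}\to\mathcal{L}[\lambda]$ with $f_\lambda(\partial p,q)=-\lambda f_\lambda(p,q)$, $f_\lambda(p,\partial q)=(\partial+\lambda)f_\lambda(p,q)$ and $f_\lambda(p,q)=-f_{-\partial-\lambda}(q,p)$. For $J,K\in C^1(\mathcal{L},\mathcal{L})$ let $[J,K]_{FN}\in C^2(\mathcal{L},\mathcal{L})$ be the Frölicher–Nijenhuis bracket $$[J,K]_{FN}(p,q)=[J(p)_\lambda K(q)]+[K(p)_\lambda J(q)]+(JK+KJ)([p_\lambda q])-K\big([J(p)_\lambda q]+[p_\lambda J(q)]\big)-J\big([K(p)_\lambda q]+[p_\lambda K(q)]\big).$$ The differential is $d_{\mathcal{N}}f=[\mathcal{N},f]_{FN}$ on $C^1(\mathcal{L},\mathcal{L})$, and on $C^2(\mathcal{L},\mathcal{L})$ it is, with $\lambda_3=-\partial-\lambda_1-\lambda_2$, $$(d_{\mathcal{N}}f)_{\lambda_1,\lambda_2}(p_1,p_2,p_3)=\sum_{i=1}^{3}(-1)^{i+1}[\mathcal{N}(p_i)_{\lambda_i}f_{\lambda_a}(p_a,p_b)]+\sum_{i<j}(-1)^{i+j}f_{\lambda_i+\lambda_j}\big([{p_i}_{\lambda_i}p_j]_{\mathcal{N}},p_k\big)-\mathcal{N}\Big(\sum_{i=1}^{3}(-1)^{i+1}[{p_i}_{\lambda_i}f_{\lambda_a}(p_a,p_b)]+\sum_{i<j}(-1)^{i+j}f_{\lambda_i+\lambda_j}\big([{p_i}_{\lambda_i}p_j],p_k\big)\Big),$$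 where $\{i,a,b\}=\{1,2,3\}$ with $a<b$ in the first and third sums, and $\{i,j,k\}=\{1,2,3\}$ in the others. Let $H^2_{\mathcal{N}}(\mathcal{L},\mathcal{L})$ be the space of 2-cocycles (the kernel of $d_{\mathcal{N}}$ on $C^2(\mathcal{L},\mathcal{L})$) modulo 2-coboundaries (the image of $d_{\mathcal{N}}$ on $C^1(\mathcal{L},\mathcal{L})$). *Deformations.* Let $n\ge 0$. A deformation of order $n$ of $\mathcal{N}$ is a sum $\mathcal{N}_t=\sum_{i=0}^{n}\mathcal{N}_it^i$ with $\mathcal{N}_i\in C^1(\mathcal{L},\mathcal{L})$ and $\mathcal{N}_0=\mathcal{N}$ that is a Nijenhuis operator on the Lie conformal algebra $\mathcal{L}[[t]]/t^{n+1}$, to which $\partial$ and the bracket are extended $\mathbb{C}[[t]]/t^{n+1}$-linearly. It is extensible if there is $\mathcal{N}_{n+1}\in C^1(\mathcal{L},\mathcal{L})$ such that $\mathcal{N}_t+\mathcal{N}_{n+1}t^{n+1}$ is a deformation of order $n+1$. Its obstruction is $$Ob_{\mathcal{N}_t}=-\frac12\sum_{i+j=n+1,\ i,j\ge1}[\mathcal{N}_i,\mathcal{N}_j]_{FN}\in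 C^2(\mathcal{L},\mathcal{L}).$$ **Theorem.** Let $\mathcal{N}_t$ be a deformation of order $n$ of $\mathcal{N}$. Then $Ob_{\mathcal{N}_t}$ is a 2-cocycle, i.e. $d_{\mathcal{N}}(Ob_{\mathcal{N}_t})=0$, and $\mathcal{N}_t$ is extensible if and only if the class $[Ob_{\mathcal{N}_t}]\in H^2_{\mathcal{N}}(\mathcal{L},\mathcal{L})$ is zero. Consequently, if $H^2_{\mathcal{N}}(\mathcal{L},\mathcal{L})=0$, then every deformation of $\mathcal{N}$ of finite order is extensible. -/

import Mathlib

noncomputable section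

namespace LieConformal

/-- `M[l]`: polynomials `∑ k, l ^ k a_k` in one variable with coefficients in the complex vector
space `M`. -/
abbrev PolyIn (M : Type*) [AddCommGroup M] [Module ℂ M] : Type _ := PolynomialModule ℂ M

section Poly

variable {M M' : Type*} [AddCommGroup M] [Module ℂ M] [AddCommGroup M'] [Module ℂ M']

/-- The value of a polynomial at the scalar `l`. As `ℂ` is infinite, an identity between
polynomials holds if and only if it holds for all scalar values of the variables. -/
def ev (l : ℂ) : PolyIn M →ₗ[ℂ] M := PolynomialModule.eval l

/-- Substitution of an endomorphism `T` for the variable: `∑ k, l ^ k a_k` goes to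
`∑ k, T ^ k (a_k)`, powers of `T` standing on the left of the coefficients. -/
def subst (T : Module.End ℂ M) : PolyIn M →ₗ[ℂ] M :=
  (Finsupp.lsum ℂ fun k => T ^ k) ∘ₗ (PolynomialModule.coeffLinearEquiv ℂ ℂ).toLinearMap

/-- The substitution of `-∂ - l` for the variable. -/
def evNeg (D : Module.End ℂ M) (l : ℂ) : PolyIn M →ₗ[ℂ] M :=
  subst (-D - l • (1 : Module.End ℂ M))

/-- Apply a linear map to each coefficient of a polynomial. -/
def mapCoeff (φ : M →ₗ[ℂ] M') : PolyIn M →ₗ[ℂ] PolyIn M' :=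
  PolynomialModule.map ℂ φ

theorem subst_single (T : Module.End ℂ M) (k : ℕ) (x : M) :
    subst T (PolynomialModule.single ℂ k x) = (T ^ k) x := by
  simp [subst]

theorem mapCoeff_single (φ : M →ₗ[ℂ] M') (k : ℕ) (x : M) :
    mapCoeff φ (PolynomialModule.single ℂ k x) = PolynomialModule.single ℂ k (φ x) := by
  simp [mapCoeff]

theorem map_subst (φ : M →ₗ[ℂ] M') (T : Module.End ℂ M) (S : Module.End ℂ M')
    (h : ∀ x, φ (T x) = S (φ x)) (a : PolyIn M) :
    φ (subst T a) = subst S (mapCoeff φ a) := by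
  have hk : ∀ (k : ℕ) (x : M), φ ((T ^ k) x) = (S ^ k) (φ x) := by
    intro k
    induction k with
    | zero => intro x; simp
    | succ k ih => intro x; rw [pow_succ', pow_succ', Module.End.mul_apply, Module.End.mul_apply,
        h, ih]
  induction a using PolynomialModule.induction_linear with
  | zero => simp
  | add a b ha hb => simp only [map_add, ha, hb]
  | single k x => rw [subst_single, mapCoeff_single, subst_single, hk]

theorem ev_mapCoeff (φ : M →ₗ[ℂ] M') (l : ℂ) (a : PolyIn M) :
    ev l (mapCoeff φ a) = φ (ev l a) :=
  PolynomialModule.eval_map ℂ φ a l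

theorem evNeg_mapCoeff (φ : M →ₗ[ℂ] M') (D : Module.End ℂ M) (D' : Module.End ℂ M')
    (h : ∀ x, φ (D x) = D' (φ x)) (l : ℂ) (a : PolyIn M) :
    evNeg D' l (mapCoeff φ a) = φ (evNeg D l a) :=
  (map_subst φ _ _ (by simp [h]) a).symm

theorem mapCoeff_add (φ ψ : M →ₗ[ℂ] M') (a : PolyIn M) :
    mapCoeff (φ + ψ) a = mapCoeff φ a + mapCoeff ψ a := by
  induction a using PolynomialModule.induction_linear with
  | zero => simp
  | add a b ha hb => simp only [map_add, ha, hb]; abel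
  | single k x => simp [mapCoeff_single]

theorem mapCoeff_smul (c : ℂ) (φ : M →ₗ[ℂ] M') (a : PolyIn M) :
    mapCoeff (c • φ) a = c • mapCoeff φ a := by
  induction a using PolynomialModule.induction_linear with
  | zero => simp
  | add a b ha hb => simp only [map_add, smul_add, ha, hb]
  | single k x => simp [mapCoeff_single, PolynomialModule.single_smul]

theorem mapCoeff_comp {M'' : Type*} [AddCommGroup M''] [Module ℂ M''] (ψ : M' →ₗ[ℂ] M'')
    (φ : M →ₗ[ℂ] M') (a : PolyIn M) :
    mapCoeff ψ (mapCoeff φ a) = mapCoeff (ψ ∘ₗ φ) a := by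
  induction a using PolynomialModule.induction_linear with
  | zero => simp
  | add a b ha hb => simp only [map_add, ha, hb]
  | single k x => simp [mapCoeff_single]

theorem mapCoeff_id (a : PolyIn M) : mapCoeff LinearMap.id a = a := by
  induction a using PolynomialModule.induction_linear with
  | zero => simp
  | add a b ha hb => simp only [map_add, ha, hb]
  | single k x => simp [mapCoeff_single]

theorem mapCoeff_zero (a : PolyIn M) : mapCoeff (0 : M →ₗ[ℂ] M') a = 0 := by
  simpa using mapCoeff_smul 0 (0 : M →ₗ[ℂ] M') a

/-- A conformal 2-cochain on the `ℂ[∂]`-module `(M, ∂ = D)` with values in `M`: a bilinear map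
`f_l : M × M → M[l]` that is conformally sesquilinear and conformally skew-symmetric. -/
structure IsTwoCochain (D : Module.End ℂ M) (f : M →ₗ[ℂ] M →ₗ[ℂ] PolyIn M) : Prop where
  /-- `f_l(∂p, q) = -l f_l(p, q)` -/
  left : ∀ (l : ℂ) (p q : M), ev l (f (D p) q) = -(l • ev l (f p q))
  /-- `f_l(p, ∂q) = (∂ + l) f_l(p, q)` -/
  right : ∀ (l : ℂ) (p q : M), ev l (f p (D q)) = D (ev l (f p q)) + l • ev l (f p q)
  /-- `f_l(p, q) = -f_{-∂-l}(q, p)` -/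
  skew : ∀ (l : ℂ) (p q : M), ev l (f p q) = -evNeg D l (f q p)

end Poly

/-- A Lie conformal algebra: a `ℂ[∂]`-module `L` (a complex vector space with the operator
`D = ∂`) with a `l`-bracket `[p_l q] ∈ L[l]` that is conformally sesquilinear, conformally
skew-symmetric and satisfies the Jacobi identity. -/
structure LieConformalAlgebra (L : Type*) [AddCommGroup L] [Module ℂ L] where
  D : Module.End ℂ L
  br : L →ₗ[ℂ] L →ₗ[ℂ] PolyIn L
  isTwoCochain : IsTwoCochain D br
  /-- `[p_l [q_m r]] = [[p_l q]_{l+m} r] + [q_m [p_l r]]` -/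
  jacobi : ∀ (l m : ℂ) (p q r : L),
    ev l (br p (ev m (br q r))) =
      ev (l + m) (br (ev l (br p q)) r) + ev m (br q (ev l (br p r)))

namespace LieConformalAlgebra

variable {L : Type*} [AddCommGroup L] [Module ℂ L] (A : LieConformalAlgebra L)

/-- The space `C¹(L, L)` of 1-cochains: the `ℂ[∂]`-linear maps `L → L`. -/
def C1 : Submodule ℂ (L →ₗ[ℂ] L) where
  carrier := {f | ∀ p, f (A.D p) = A.D (f p)}
  zero_mem' := by simp
  add_mem' := by
    intro f g hf hg p
    simp [hf p, hg p]
  smul_mem' := by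
    intro c f hf p
    simp [hf p]

/-- The conformal 2-cochains as a subspace of the bilinear maps `L × L → L[l]`. -/
def twoCochains : Submodule ℂ (L →ₗ[ℂ] L →ₗ[ℂ] PolyIn L) where
  carrier := {f | IsTwoCochain A.D f}
  zero_mem' := ⟨by simp, by simp, by simp⟩
  add_mem' := by
    intro f g hf hg
    refine ⟨fun l p q => ?_, fun l p q => ?_, fun l p q => ?_⟩
    · simp only [LinearMap.add_apply, map_add, hf.left, hg.left, smul_add]; abel
    · simp only [LinearMap.add_apply, map_add, hf.right, hg.right, smul_add]; abel
    · simp only [LinearMap.add_apply, map_add, hf.skew l p q, hg.skew l p q]; abel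
  smul_mem' := by
    intro c f hf
    refine ⟨fun l p q => ?_, fun l p q => ?_, fun l p q => ?_⟩
    · simp only [LinearMap.smul_apply, map_smul, hf.left, smul_neg, smul_comm c l]
    · simp only [LinearMap.smul_apply, map_smul, hf.right, smul_add, smul_comm c l]
    · simp only [LinearMap.smul_apply, map_smul, hf.skew l p q, smul_neg]

/-- The vector space `C²(L, L)` of conformal 2-cochains. -/
def C2 : Type _ := A.twoCochains

instance : AddCommGroup A.C2 := inferInstanceAs (AddCommGroup A.twoCochains)

instance : Module ℂ A.C2 := inferInstanceAs (Module ℂ A.twoCochains)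

/-- The bilinear map underlying a 2-cochain. -/
def C2.val {A : LieConformalAlgebra L} (f : A.C2) : L →ₗ[ℂ] L →ₗ[ℂ] PolyIn L := Subtype.val f

theorem C2.ext {A : LieConformalAlgebra L} {f g : A.C2} (h : f.val = g.val) : f = g :=
  Subtype.ext h

theorem C2.val_add {A : LieConformalAlgebra L} (f g : A.C2) : (f + g).val = f.val + g.val := rfl

theorem C2.val_smul {A : LieConformalAlgebra L} (c : ℂ) (f : A.C2) : (c • f).val = c • f.val := rfl

/-- `N` is a Nijenhuis operator:
`[N(p)_l N(q)] = N([N(p)_l q] + [p_l N(q)] - N([p_l q]))`. -/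
def IsNijenhuis (N : A.C1) : Prop :=
  ∀ (l : ℂ) (p q : L),
    ev l (A.br (N.1 p) (N.1 q)) =
      N.1 (ev l (A.br (N.1 p) q) + ev l (A.br p (N.1 q)) - N.1 (ev l (A.br p q)))

/-! ### The Frölicher-Nijenhuis bracket in degree one and the second cohomology -/

/-- The bilinear map `(p, q) ↦ [J(p)_l K(q)]`. -/
def br₂ (J K : L →ₗ[ℂ] L) : L →ₗ[ℂ] L →ₗ[ℂ] PolyIn L := A.br.compl₁₂ J K

/-- The Frölicher-Nijenhuis bracket of two 1-cochains as a bilinear map: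
`[J, K]_l(p, q) = [J(p)_l K(q)] + [K(p)_l J(q)] + (JK + KJ)([p_l q])
  - K([J(p)_l q] + [p_l J(q)]) - J([K(p)_l q] + [p_l K(q)])`. -/
def fnBilin (J K : L →ₗ[ℂ] L) : L →ₗ[ℂ] L →ₗ[ℂ] PolyIn L :=
  A.br₂ J K + A.br₂ K J + A.br.compr₂ (mapCoeff (J ∘ₗ K + K ∘ₗ J))
    - (A.br₂ J LinearMap.id + A.br₂ LinearMap.id J).compr₂ (mapCoeff K)
    - (A.br₂ K LinearMap.id + A.br₂ LinearMap.id K).compr₂ (mapCoeff J)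

theorem br₂_mem (J K : A.C1) : A.br₂ J.1 K.1 + A.br₂ K.1 J.1 ∈ A.twoCochains := by
  have hJ := J.2
  have hK := K.2
  refine ⟨fun l p q => ?_, fun l p q => ?_, fun l p q => ?_⟩
  · simp only [br₂, LinearMap.add_apply, LinearMap.compl₁₂_apply, map_add, hJ p, hK p,
      A.isTwoCochain.left, smul_add]
    abel
  · simp only [br₂, LinearMap.add_apply, LinearMap.compl₁₂_apply, map_add, hJ q, hK q,
      A.isTwoCochain.right, smul_add]
    abel
  · simp only [br₂, LinearMap.add_apply, LinearMap.compl₁₂_apply, map_add]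
    rw [A.isTwoCochain.skew l (J.1 p), A.isTwoCochain.skew l (K.1 p)]
    abel

theorem compr₂_mem {f : L →ₗ[ℂ] L →ₗ[ℂ] PolyIn L} (hf : f ∈ A.twoCochains) (J : A.C1) :
    f.compr₂ (mapCoeff J.1) ∈ A.twoCochains := by
  have hJ := J.2
  have hf' : IsTwoCochain A.D f := hf
  refine ⟨fun l p q => ?_, fun l p q => ?_, fun l p q => ?_⟩
  · simp only [LinearMap.compr₂_apply, ev_mapCoeff, hf'.left, map_neg, map_smul]
  · simp only [LinearMap.compr₂_apply, ev_mapCoeff, hf'.right, map_add, map_smul, hJ _]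
  · simp only [LinearMap.compr₂_apply, ev_mapCoeff,
      evNeg_mapCoeff J.1 A.D A.D (fun x => hJ x), hf'.skew l p q, map_neg]

theorem fnBilin_mem (J K : A.C1) : A.fnBilin J.1 K.1 ∈ A.twoCochains := by
  have hid : (LinearMap.id : L →ₗ[ℂ] L) ∈ A.C1 := fun p => rfl
  have hc : J.1 ∘ₗ K.1 + K.1 ∘ₗ J.1 ∈ A.C1 := by
    have hJ := J.2
    have hK := K.2
    intro p
    simp [hJ _, hK _]
  have h1 := A.br₂_mem J K
  have h2 : A.br.compr₂ (mapCoeff (J.1 ∘ₗ K.1 + K.1 ∘ₗ J.1)) ∈ A.twoCochains :=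
    A.compr₂_mem A.isTwoCochain ⟨_, hc⟩
  have h3 := A.compr₂_mem (A.br₂_mem J ⟨_, hid⟩) K
  have h4 := A.compr₂_mem (A.br₂_mem K ⟨_, hid⟩) J
  exact A.twoCochains.sub_mem (A.twoCochains.sub_mem (A.twoCochains.add_mem h1 h2) h3) h4

/-- The Frölicher-Nijenhuis bracket `C¹(L, L) × C¹(L, L) → C²(L, L)`. -/
def fn (J K : A.C1) : A.C2 :=
  (⟨A.fnBilin J.1 K.1, A.fnBilin_mem J K⟩ : A.twoCochains)

theorem fn_val (J K : A.C1) : (A.fn J K).val = A.fnBilin J.1 K.1 := rfl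

/-- The differential `d_N = [N, -] : C¹(L, L) → C²(L, L)`. -/
def d1 (N : A.C1) : A.C1 →ₗ[ℂ] A.C2 where
  toFun f := A.fn N f
  map_add' f g := by
    apply C2.ext
    ext1 p
    ext1 q
    simp only [C2.val_add, fn_val, fnBilin, br₂, Submodule.coe_add, LinearMap.add_apply, LinearMap.sub_apply,
      LinearMap.compr₂_apply, LinearMap.compl₁₂_apply, LinearMap.id_apply, LinearMap.comp_add,
      LinearMap.add_comp, map_add, mapCoeff_add]
    abel
  map_smul' c f := by
    apply C2.ext
    ext1 p
    ext1 q
    simp only [C2.val_smul, fn_val, fnBilin, br₂, Submodule.coe_smul, LinearMap.add_apply, LinearMap.sub_apply,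
      LinearMap.smul_apply, LinearMap.compr₂_apply, LinearMap.compl₁₂_apply, LinearMap.id_apply,
      LinearMap.comp_smul, LinearMap.smul_comp, map_add, map_smul, mapCoeff_add, mapCoeff_smul,
      smul_add, smul_sub, RingHom.id_apply]

/-- The part `∑ (-1)^{i+1} [(φ p_i)_{l_i} f(p₁, p̂_i, p₃)]` of a differential of `f ∈ C²(L, L)`,
where `(l₁, l₂, l₃) = (l, m, -∂ - l - m)`. -/
def actionPart (φ : L →ₗ[ℂ] L) (f : A.C2) (l m : ℂ) (p q r : L) : L :=
  ev l (A.br (φ p) (ev m (f.val q r))) - ev m (A.br (φ q) (ev l (f.val p r)))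
    + evNeg A.D (l + m) (A.br (φ r) (ev l (f.val p q)))

/-- The part `∑_{i<j} (-1)^{i+j} f_{l_i + l_j}(β_{l_i}(p_i, p_j), p_k)` of a differential of
`f ∈ C²(L, L)`, for a bilinear `β_l : L × L → L`, where `(l₁, l₂, l₃) = (l, m, -∂ - l - m)`;
thus `l₁ + l₃ = -∂ - m` and `l₂ + l₃ = -∂ - l`. -/
def insertPart (β : ℂ → L → L → L) (f : A.C2) (l m : ℂ) (p q r : L) : L :=
  -ev (l + m) (f.val (β l p q) r) + evNeg A.D m (f.val (β l p r) q)
    - evNeg A.D l (f.val (β m q r) p)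

/-- The deformed bracket `[p_l q]_N = [N(p)_l q] + [p_l N(q)] - N([p_l q])`. -/
def brN (N : A.C1) (l : ℂ) (p q : L) : L :=
  ev l (A.br (N.1 p) q) + ev l (A.br p (N.1 q)) - N.1 (ev l (A.br p q))

/-- The differential `d_N` on `C²(L, L)`. The 3-cochain `d_N f` is recorded through its values
`(d_N f)_{l, m}(p, q, r)`, which determine it, in the space of all functions of
`l, m, p, q, r`. -/
def d2 (N : A.C1) : A.C2 →ₗ[ℂ] (ℂ → ℂ → L → L → L → L) where
  toFun f l m p q r :=
    A.actionPart N.1 f l m p q r + A.insertPart (A.brN N) f l m p q r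
      - N.1 (A.actionPart LinearMap.id f l m p q r
        + A.insertPart (fun l p q => ev l (A.br p q)) f l m p q r)
  map_add' f g := by
    funext l m p q r
    simp only [actionPart, insertPart, C2.val_add, LinearMap.add_apply, map_add,
      Pi.add_apply, map_sub, map_neg]
    abel
  map_smul' c f := by
    funext l m p q r
    simp only [actionPart, insertPart, C2.val_smul, LinearMap.smul_apply, map_add,
      map_smul, Pi.smul_apply, map_sub, map_neg, smul_add, smul_sub, smul_neg, RingHom.id_apply]

/-- The 2-cocycles of the complex `(C*(L, L), d_N)`. -/
def Z2 (N : A.C1) : Submodule ℂ A.C2 := LinearMap.ker (A.d2 N)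

/-- The 2-coboundaries of the complex `(C*(L, L), d_N)`. -/
def B2 (N : A.C1) : Submodule ℂ A.C2 := LinearMap.range (A.d1 N)

/-- The second cohomology `H²_N(L, L)` of the Nijenhuis operator `N`: 2-cocycles modulo
2-coboundaries (`B2 N ≤ Z2 N` when `N` is a Nijenhuis operator, since then `d_N ∘ d_N = 0`). -/
abbrev H2 (N : A.C1) : Type _ := A.Z2 N ⧸ (A.B2 N).submoduleOf (A.Z2 N)

/-- The class in `H²_N(L, L)` of a 2-cocycle. -/
def H2.mk (N : A.C1) (f : A.C2) (hf : f ∈ A.Z2 N) : A.H2 N :=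
  Submodule.Quotient.mk ⟨f, hf⟩

/-! ### Truncated power series and deformations of finite order -/

/-- The pairs `(i, j)` of exponents `≤ k` with `i + j = s`. -/
def expPairs (k s : ℕ) : Finset (Fin (k + 1) × Fin (k + 1)) :=
  Finset.univ.filter fun x => (x.1 : ℕ) + x.2 = s

theorem sum_expPairs_right {M : Type*} [AddCommMonoid M] (k s : ℕ) (hs : s < k + 1)
    (F : Fin (k + 1) → Fin (k + 1) → Fin (k + 1) → M) :
    ∑ x ∈ expPairs k s, ∑ y ∈ expPairs k x.2, F x.1 y.1 y.2 =
      ∑ z ∈ (Finset.univ : Finset (Fin (k + 1) × Fin (k + 1) × Fin (k + 1))).filter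
        (fun z => (z.1 : ℕ) + z.2.1 + z.2.2 = s), F z.1 z.2.1 z.2.2 := by
  rw [Finset.sum_sigma']
  refine Finset.sum_bij' (fun x _ => (x.1.1, x.2.1, x.2.2))
    (fun z hz => ⟨(z.1, ⟨min ((z.2.1 : ℕ) + z.2.2) k, by omega⟩), z.2⟩) ?_ ?_ ?_ ?_ ?_
  · rintro ⟨⟨a, b⟩, ⟨c, d⟩⟩ h
    simp [expPairs] at h ⊢
    omega
  · rintro ⟨a, b, c⟩ h
    simp [expPairs] at h ⊢
    omega
  · rintro ⟨⟨a, b⟩, ⟨c, d⟩⟩ h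
    simp [expPairs] at h ⊢
    apply Fin.ext
    simp
    omega
  · rintro ⟨a, b, c⟩ h
    rfl
  · rintro ⟨⟨a, b⟩, ⟨c, d⟩⟩ h
    rfl

theorem sum_expPairs_left {M : Type*} [AddCommMonoid M] (k s : ℕ) (hs : s < k + 1)
    (F : Fin (k + 1) → Fin (k + 1) → Fin (k + 1) → M) :
    ∑ x ∈ expPairs k s, ∑ y ∈ expPairs k x.1, F y.1 y.2 x.2 =
      ∑ z ∈ (Finset.univ : Finset (Fin (k + 1) × Fin (k + 1) × Fin (k + 1))).filter
        (fun z => (z.1 : ℕ) + z.2.1 + z.2.2 = s), F z.1 z.2.1 z.2.2 := by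
  rw [Finset.sum_sigma']
  refine Finset.sum_bij' (fun x _ => (x.2.1, x.2.2, x.1.2))
    (fun z hz => ⟨(⟨min ((z.1 : ℕ) + z.2.1) k, by omega⟩, z.2.2), (z.1, z.2.1)⟩) ?_ ?_ ?_ ?_ ?_
  · rintro ⟨⟨a, b⟩, ⟨c, d⟩⟩ h
    simp [expPairs] at h ⊢
    omega
  · rintro ⟨a, b, c⟩ h
    simp [expPairs] at h ⊢
    omega
  · rintro ⟨⟨a, b⟩, ⟨c, d⟩⟩ h
    simp [expPairs] at h ⊢
    apply Fin.ext
    simp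
    omega
  · rintro ⟨a, b, c⟩ h
    rfl
  · rintro ⟨⟨a, b⟩, ⟨c, d⟩⟩ h
    rfl

theorem sum_expTriples_swap {M : Type*} [AddCommMonoid M] (k s : ℕ)
    (F : Fin (k + 1) → Fin (k + 1) → Fin (k + 1) → M) :
    ∑ z ∈ (Finset.univ : Finset (Fin (k + 1) × Fin (k + 1) × Fin (k + 1))).filter
        (fun z => (z.1 : ℕ) + z.2.1 + z.2.2 = s), F z.2.1 z.1 z.2.2 =
      ∑ z ∈ (Finset.univ : Finset (Fin (k + 1) × Fin (k + 1) × Fin (k + 1))).filter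
        (fun z => (z.1 : ℕ) + z.2.1 + z.2.2 = s), F z.1 z.2.1 z.2.2 := by
  refine Finset.sum_bij' (fun z _ => (z.2.1, z.1, z.2.2)) (fun z _ => (z.2.1, z.1, z.2.2))
    ?_ ?_ ?_ ?_ ?_
  · rintro ⟨a, b, c⟩ h
    simp at h ⊢
    omega
  · rintro ⟨a, b, c⟩ h
    simp at h ⊢
    omega
  · rintro ⟨a, b, c⟩ h
    rfl
  · rintro ⟨a, b, c⟩ h
    rfl
  · rintro ⟨a, b, c⟩ h
    rfl

set_option synthInstance.maxHeartbeats 400000 in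
/-- The `ℂ[[t]]/t^{k+1}`-bilinear extension of the bracket of `L` to `L[[t]]/t^{k+1}`, where
`a : Fin (k + 1) → L` stands for `∑ i, a i t^i`: the coefficient of `t^s` in `[a_l b]` is
`∑_{i+j=s} [(a i)_l (b j)]`. -/
def truncBr (k : ℕ) :
    (Fin (k + 1) → L) →ₗ[ℂ] (Fin (k + 1) → L) →ₗ[ℂ] PolyIn (Fin (k + 1) → L) :=
  ∑ s : Fin (k + 1), ∑ x ∈ expPairs k s,
    (A.br.compl₁₂ (LinearMap.proj x.1 : (Fin (k + 1) → L) →ₗ[ℂ] L)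
      (LinearMap.proj x.2 : (Fin (k + 1) → L) →ₗ[ℂ] L)).compr₂
      (mapCoeff (LinearMap.single ℂ (fun _ : Fin (k + 1) => L) s))

theorem mapCoeff_truncBr (k : ℕ) (a b : Fin (k + 1) → L) (s : Fin (k + 1)) :
    mapCoeff (LinearMap.proj s : (Fin (k + 1) → L) →ₗ[ℂ] L) (A.truncBr k a b) =
      ∑ x ∈ expPairs k s, A.br (a x.1) (b x.2) := by
  simp only [truncBr, LinearMap.sum_apply, map_sum, LinearMap.compr₂_apply,
    LinearMap.compl₁₂_apply, LinearMap.proj_apply]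
  rw [Finset.sum_eq_single s]
  · refine Finset.sum_congr rfl fun x _ => ?_
    rw [mapCoeff_comp, LinearMap.proj_comp_single_same, mapCoeff_id]
  · intro u _ hu
    refine Finset.sum_eq_zero fun x _ => ?_
    rw [mapCoeff_comp, LinearMap.proj_comp_single_ne _ _ _ _ hu.symm, mapCoeff_zero]
  · simp

theorem ev_truncBr (k : ℕ) (l : ℂ) (a b : Fin (k + 1) → L) (s : Fin (k + 1)) :
    ev l (A.truncBr k a b) s = ∑ x ∈ expPairs k s, ev l (A.br (a x.1) (b x.2)) := by
  have h := ev_mapCoeff (LinearMap.proj s : (Fin (k + 1) → L) →ₗ[ℂ] L) l (A.truncBr k a b)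
  rw [mapCoeff_truncBr, map_sum] at h
  exact h.symm

theorem evNeg_truncBr (k : ℕ) (l : ℂ) (a b : Fin (k + 1) → L) (s : Fin (k + 1)) :
    evNeg (A.D.compLeft (Fin (k + 1))) l (A.truncBr k a b) s =
      ∑ x ∈ expPairs k s, evNeg A.D l (A.br (a x.1) (b x.2)) := by
  have h := evNeg_mapCoeff (LinearMap.proj s : (Fin (k + 1) → L) →ₗ[ℂ] L)
    (A.D.compLeft (Fin (k + 1))) A.D (fun x => rfl) l (A.truncBr k a b)
  rw [mapCoeff_truncBr, map_sum] at h
  exact h.symm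

/-- The Lie conformal algebra `L[[t]]/t^{k+1}`, with `∂` and the bracket extended
`ℂ[[t]]/t^{k+1}`-linearly. -/
def trunc (k : ℕ) : LieConformalAlgebra (Fin (k + 1) → L) where
  D := A.D.compLeft (Fin (k + 1))
  br := A.truncBr k
  isTwoCochain := by
    refine ⟨fun l p q => ?_, fun l p q => ?_, fun l p q => ?_⟩
    · funext s
      simp [ev_truncBr, A.isTwoCochain.left, Finset.smul_sum]
    · funext s
      simp [ev_truncBr, A.isTwoCochain.right, Finset.smul_sum, Finset.sum_add_distrib]
    · funext s
      rw [Pi.neg_apply, ev_truncBr, evNeg_truncBr, ← Finset.sum_neg_distrib]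
      refine Finset.sum_bij' (fun x _ => x.swap) (fun x _ => x.swap) ?_ ?_ ?_ ?_ ?_
      · rintro ⟨a, b⟩ h
        simp [expPairs] at h ⊢
        omega
      · rintro ⟨a, b⟩ h
        simp [expPairs] at h ⊢
        omega
      · intro x _
        rfl
      · intro x _
        rfl
      · intro x _
        exact A.isTwoCochain.skew l _ _
  jacobi := by
    intro l m p q r
    funext s
    rw [Pi.add_apply]
    simp only [ev_truncBr, map_sum, LinearMap.sum_apply]
    rw [sum_expPairs_right k s s.2 (fun i u v => ev l (A.br (p i) (ev m (A.br (q u) (r v))))),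
      sum_expPairs_left k s s.2
        (fun i u v => ev (l + m) (A.br (ev l (A.br (p i) (q u))) (r v))),
      sum_expPairs_right k s s.2 (fun u i v => ev m (A.br (q u) (ev l (A.br (p i) (r v))))),
      ← sum_expTriples_swap k s
        (fun u i v => ev m (A.br (q u) (ev l (A.br (p i) (r v))))),
      ← Finset.sum_add_distrib]
    exact Finset.sum_congr rfl fun z _ => A.jacobi l m _ _ _

/-- The `ℂ[[t]]/t^{k+1}`-linear map `∑ i, N i t^i` on `L[[t]]/t^{k+1}`: the coefficient of `t^s`
in the image of `a` is `∑_{i+j=s} N i (a j)`. -/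
def seriesMap {k : ℕ} (N : Fin (k + 1) → A.C1) : (A.trunc k).C1 where
  val := LinearMap.pi fun s =>
    ∑ x ∈ expPairs k s, (N x.1).1 ∘ₗ (LinearMap.proj x.2 : (Fin (k + 1) → L) →ₗ[ℂ] L)
  property := by
    intro p
    funext s
    have h : ∀ i x, (N i).1 (A.D x) = A.D ((N i).1 x) := fun i x => (N i).2 x
    simp [trunc, h]

/-- A deformation of order `k` of the operator `N`: maps `N₀ = N, N₁, …, N_k ∈ C¹(L, L)` such that
`∑ i, N_i t^i` is a Nijenhuis operator on `L[[t]]/t^{k+1}`. -/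
structure Deformation (N : A.C1) (k : ℕ) where
  coeff : Fin (k + 1) → A.C1
  coeff_zero : coeff 0 = N
  isNijenhuis : (A.trunc k).IsNijenhuis (A.seriesMap coeff)

/-- A deformation of order `k` is extensible if a term `N_{k+1} t^{k+1}` can be added to obtain a
deformation of order `k + 1`. -/
def Deformation.Extensible {A : LieConformalAlgebra L} {N : A.C1} {k : ℕ}
    (T : A.Deformation N k) : Prop :=
  ∃ T' : A.Deformation N (k + 1), ∀ i : Fin (k + 1), T'.coeff i.castSucc = T.coeff i

/-- The obstruction `-½ ∑ [N_i, N_j]` of a deformation of order `k`, summed over the `i, j` with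
`i + j = k + 1`, `1 ≤ i` and `1 ≤ j`. -/
def Deformation.obstruction {A : LieConformalAlgebra L} {N : A.C1} {k : ℕ}
    (T : A.Deformation N k) : A.C2 :=
  (-(1 / 2) : ℂ) •
    ∑ x ∈ (expPairs k (k + 1)).filter (fun x => 1 ≤ (x.1 : ℕ) ∧ 1 ≤ (x.2 : ℕ)),
      A.fn (T.coeff x.1) (T.coeff x.2)

end LieConformalAlgebra

end LieConformal

end

/-! View `L[[t]]/t^{n+2} → L[[t]]/t^{n+1}` as a small extension. Lift the deformation `N_t` to any
`S = N_t + t^{n+1} M` on `L[[t]]/t^{n+2}`. The bracket `[S, S]` is `t`-linear, so it vanishes as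
soon as one argument is divisible by `t`: there it is `t` times the bracket `[N_t, N_t] = 0`.
Hence `[S, S]` only depends on the constant terms of its arguments, and on these it takes the
values `t^{n+1} c`, where `c = 2 (d_N M - Ob)` is the coefficient of `t^{n+1}` in `[S, S]`.

So `S` is a Nijenhuis operator if and only if `d_N M = Ob`, which makes extensibility equivalent to
`Ob` being a coboundary. For `M = 0`, the identity `[S, [S, S]] = 0` over `L[[t]]/t^{n+2}`, which
holds for every `S`, reduces to `t^{n+1} d_N c = 0`, which is the cocycle condition on `Ob`.
-/

noncomputable section

namespace LieConformal

open Finset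

theorem polynomialModule_eq_zero_of_forall_eval_eq_zero {K M : Type*} [Field K] [Infinite K]
    [AddCommGroup M] [Module K M] {a : PolynomialModule K M}
    (h : ∀ l : K, PolynomialModule.eval l a = 0) : a = 0 := by
  ext k
  refine (Module.forall_dual_apply_eq_zero_iff K _).mp fun φ => ?_
  let P : Polynomial K := a.coeff.sum fun i x => Polynomial.monomial i (φ x)
  have hP : P = 0 := Polynomial.funext fun l => by
    have hl : φ (a.coeff.sum fun i x => l ^ i • x) = 0 := by
      rw [← map_zero φ, ← h l]
      rfl
    simpa [P, Finsupp.sum, Polynomial.eval_finsetSum, mul_comm] using hl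
  have hk : P.coeff k = φ (a.coeff k) := by
    simp +contextual [P, Finsupp.sum, Polynomial.finsetSum_coeff, Polynomial.coeff_monomial]
  rw [← hk, hP, Polynomial.coeff_zero]

namespace LieConformalAlgebra

section expPairs

variable {M : Type*} [AddCommMonoid M] {k : ℕ}

theorem mem_expPairs {s : ℕ} {x : Fin (k + 1) × Fin (k + 1)} :
    x ∈ expPairs k s ↔ (x.1 : ℕ) + x.2 = s := by
  simp [expPairs]

theorem sum_expPairs (s : ℕ) (G : Fin (k + 1) × Fin (k + 1) → M) :
    ∑ x ∈ expPairs k s, G x =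
      ∑ i : Fin (k + 1), ∑ j : Fin (k + 1), if (i : ℕ) + j = s then G (i, j) else 0 := by
  rw [expPairs, sum_filter, Fintype.sum_prod_type]

theorem sum_expPairs_swap (s : ℕ) (G : Fin (k + 1) × Fin (k + 1) → M) :
    ∑ x ∈ expPairs k s, G x = ∑ x ∈ expPairs k s, G x.swap :=
  sum_equiv (Equiv.prodComm _ _) (by simp [mem_expPairs, add_comm]) (by simp)

theorem sum_expPairs_of_fst_eq_zero (s : Fin (k + 1)) (G : Fin (k + 1) × Fin (k + 1) → M)
    (hG : ∀ x, x.1 ≠ 0 → G x = 0) : ∑ x ∈ expPairs k s, G x = G (0, s) := by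
  refine sum_eq_single_of_mem (0, s) (by simp [mem_expPairs]) fun x hx hne => hG x fun h0 => ?_
  refine hne (Prod.ext h0 (Fin.ext ?_))
  simpa [h0] using mem_expPairs.mp hx

theorem sum_expPairs_of_snd_eq_last (s : Fin (k + 1)) (G : Fin (k + 1) × Fin (k + 1) → M)
    (hG : ∀ x, x.2 ≠ Fin.last k → G x = 0) :
    ∑ x ∈ expPairs k s, G x =
      Pi.single (M := fun _ => M) (Fin.last k) (G (0, Fin.last k)) s := by
  have hs : k = s ↔ s = Fin.last k := by simp [Fin.ext_iff, eq_comm]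
  rw [sum_expPairs, Fintype.sum_eq_single 0, Fintype.sum_eq_single (Fin.last k)]
  · simp [Pi.single_apply, hs]
  · intro j hj
    simp [hG (0, j) hj]
  · intro i hi
    refine sum_eq_zero fun j _ => ite_eq_right_iff.mpr fun hij => hG (i, j) ?_
    rintro rfl
    have hpos : 0 < (i : ℕ) := Nat.pos_of_ne_zero (Fin.val_ne_zero_iff.mpr hi)
    rw [Fin.val_last] at hij
    omega

theorem sum_expPairs_zero (G : Fin (k + 1) × Fin (k + 1) → M) :
    ∑ x ∈ expPairs k ((0 : Fin (k + 1)) : ℕ), G x = G (0, 0) := by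
  have h : expPairs k ((0 : Fin (k + 1)) : ℕ) = {(0, 0)} := by
    ext x
    simp [mem_expPairs, Prod.ext_iff]
  rw [h, sum_singleton]

theorem sum_expPairs_succ (s : Fin (k + 1)) (G : Fin (k + 2) × Fin (k + 2) → M) :
    ∑ x ∈ expPairs (k + 1) s.succ, G x =
      G (0, s.succ) + ∑ x ∈ expPairs k s, G (x.1.succ, x.2.castSucc) := by
  have hlast (i : Fin (k + 1)) : (i : ℕ) + 1 + (k + 1) ≠ s + 1 := by omega
  have hshift (i j : Fin (k + 1)) : (i : ℕ) + 1 + j = s + 1 ↔ (i : ℕ) + j = s := by omega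
  rw [sum_expPairs, sum_expPairs, Fin.sum_univ_succ]
  congr 1
  · simp [← Fin.ext_iff, -Fin.val_succ]
  · simp [Fin.sum_univ_castSucc, hlast, hshift]

theorem sum_expPairs_castSucc (s : Fin (k + 1)) (G : Fin (k + 2) × Fin (k + 2) → M) :
    ∑ x ∈ expPairs (k + 1) s.castSucc, G x =
      ∑ x ∈ expPairs k s, G (x.1.castSucc, x.2.castSucc) := by
  have h₁ (j : ℕ) : k + 1 + j ≠ s := by omega
  have h₂ (j : ℕ) : j + (k + 1) ≠ s := by omega
  rw [sum_expPairs, sum_expPairs]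
  simp [Fin.sum_univ_castSucc, h₁, h₂]

theorem sum_expPairs_last (G : Fin (k + 2) × Fin (k + 2) → M) :
    ∑ x ∈ expPairs (k + 1) (k + 1), G x =
      ∑ x ∈ expPairs k (k + 1), G (x.1.castSucc, x.2.castSucc)
        + G (0, Fin.last (k + 1)) + G (Fin.last (k + 1), 0) := by
  rw [sum_expPairs, sum_expPairs]
  simp [Fin.sum_univ_castSucc (n := k + 1), sum_add_distrib]

end expPairs

variable {L : Type*} [AddCommGroup L] [Module ℂ L] (A : LieConformalAlgebra L)

section Cochains

variable {A}

theorem C2.ext_ev {f g : A.C2} (h : ∀ l p q, ev l (f.val p q) = ev l (g.val p q)) : f = g := by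
  refine C2.ext (LinearMap.ext fun p => LinearMap.ext fun q => sub_eq_zero.mp ?_)
  refine polynomialModule_eq_zero_of_forall_eval_eq_zero fun l => ?_
  exact (map_sub (ev l) _ _).trans (sub_eq_zero.mpr (h l p q))

theorem C2.val_sum {ι : Type*} (s : Finset ι) (f : ι → A.C2) :
    (∑ i ∈ s, f i).val = ∑ i ∈ s, (f i).val :=
  map_sum A.twoCochains.subtype f s

theorem C2.evNeg_val (f : A.C2) (l : ℂ) (p q : L) :
    evNeg A.D l (f.val p q) = -ev l (f.val q p) := by
  rw [(show IsTwoCochain A.D f.val from f.2).skew l q p, neg_neg]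

theorem C2.val_apply_eq_zero_comm (f : A.C2) {p : L} (h : ∀ l q, ev l (f.val p q) = 0) (l : ℂ)
    (q : L) : ev l (f.val q p) = 0 := by
  have hpq : f.val p q = 0 := polynomialModule_eq_zero_of_forall_eval_eq_zero fun m => h m q
  rw [(show IsTwoCochain A.D f.val from f.2).skew, hpq, map_zero, neg_zero]

end Cochains

/-- The polarized Nijenhuis torsion `[J(p)_l K(q)] - J([K(p)_l q] + [p_l K(q)]) + J(K([p_l q]))`;
the Frölicher-Nijenhuis bracket is its symmetrization in `J` and `K`. -/
def torsion (J K : A.C1) (l : ℂ) (p q : L) : L :=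
  ev l (A.br (J.1 p) (K.1 q)) - J.1 (ev l (A.br (K.1 p) q)) - J.1 (ev l (A.br p (K.1 q)))
    + J.1 (K.1 (ev l (A.br p q)))

theorem ev_fn (J K : A.C1) (l : ℂ) (p q : L) :
    ev l ((A.fn J K).val p q) = A.torsion J K l p q + A.torsion K J l p q := by
  simp only [fn_val, fnBilin, br₂, torsion, LinearMap.add_apply, LinearMap.sub_apply,
    LinearMap.compr₂_apply, LinearMap.compl₁₂_apply, LinearMap.id_apply, map_add, map_sub,
    ev_mapCoeff, LinearMap.comp_apply]
  abel

theorem fn_comm (J K : A.C1) : A.fn J K = A.fn K J :=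
  C2.ext_ev fun l p q => by rw [ev_fn, ev_fn, add_comm]

theorem ev_fn_self (N : A.C1) (l : ℂ) (p q : L) :
    ev l ((A.fn N N).val p q) = (2 : ℂ) • A.torsion N N l p q := by
  rw [ev_fn, two_smul]

theorem isNijenhuis_iff_torsion_eq_zero (N : A.C1) :
    A.IsNijenhuis N ↔ ∀ l p q, A.torsion N N l p q = 0 := by
  refine forall₃_congr fun l p q => ?_
  rw [← sub_eq_zero, torsion, map_sub, map_add]
  abel_nf

theorem isNijenhuis_iff_fn_self_eq_zero (N : A.C1) : A.IsNijenhuis N ↔ A.fn N N = 0 := by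
  rw [isNijenhuis_iff_torsion_eq_zero]
  refine ⟨fun h => C2.ext_ev fun l p q => ?_, fun h l p q => ?_⟩
  · rw [ev_fn_self, h, smul_zero]
    exact (map_zero (ev l)).symm
  · have h2 : (2 : ℂ) • A.torsion N N l p q = 0 := by
      rw [← ev_fn_self, h]
      exact map_zero (ev l)
    exact (smul_eq_zero.mp h2).resolve_left two_ne_zero

theorem d2_apply (N : A.C1) (f : A.C2) (l m : ℂ) (p q r : L) :
    A.d2 N f l m p q r =
      ev l (A.br (N.1 p) (ev m (f.val q r))) - ev m (A.br (N.1 q) (ev l (f.val p r)))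
        - ev (l + m) (A.br (ev l (f.val p q)) (N.1 r))
        - ev (l + m) (f.val (A.brN N l p q) r) - ev m (f.val q (A.brN N l p r))
        + ev l (f.val p (A.brN N m q r))
        - N.1 (ev l (A.br p (ev m (f.val q r))) - ev m (A.br q (ev l (f.val p r)))
          - ev (l + m) (A.br (ev l (f.val p q)) r)
          - ev (l + m) (f.val (ev l (A.br p q)) r) - ev m (f.val q (ev l (A.br p r)))
          + ev l (f.val p (ev m (A.br q r)))) := by
  have evNeg_br (l : ℂ) (p q : L) : evNeg A.D l (A.br p q) = -ev l (A.br q p) := by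
    rw [A.isTwoCochain.skew l q p, neg_neg]
  simp only [d2, LinearMap.coe_mk, AddHom.coe_mk, actionPart, insertPart, evNeg_br, C2.evNeg_val,
    LinearMap.id_apply, map_add, map_sub, map_neg]
  abel

theorem d2_fn_self (J : A.C1) : A.d2 J (A.fn J J) = 0 := by
  funext l m p q r
  simp only [d2_apply, ev_fn, torsion, brN, map_add, map_sub, LinearMap.add_apply,
    LinearMap.sub_apply, Pi.zero_apply]
  -- After every inner bracket is expanded by the Jacobi identity, the terms cancel in pairs.
  simp only [A.jacobi l m, map_add]
  abel

section Truncation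

variable {k : ℕ}

theorem ev_trunc_br_apply (l : ℂ) (a b : Fin (k + 1) → L) (s : Fin (k + 1)) :
    ev l ((A.trunc k).br a b) s = ∑ x ∈ expPairs k s, ev l (A.br (a x.1) (b x.2)) :=
  A.ev_truncBr k l a b s

theorem seriesMap_apply (F : Fin (k + 1) → A.C1) (a : Fin (k + 1) → L) (s : Fin (k + 1)) :
    (A.seriesMap F).1 a s = ∑ x ∈ expPairs k s, (F x.1).1 (a x.2) := by
  simp [seriesMap]

theorem ev_trunc_br_apply_zero (l : ℂ) (a b : Fin (k + 1) → L) :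
    ev l ((A.trunc k).br a b) 0 = ev l (A.br (a 0) (b 0)) := by
  rw [ev_trunc_br_apply, sum_expPairs_zero]

theorem seriesMap_apply_zero (F : Fin (k + 1) → A.C1) (a : Fin (k + 1) → L) :
    (A.seriesMap F).1 a 0 = (F 0).1 (a 0) := by
  rw [seriesMap_apply, sum_expPairs_zero]

theorem brN_seriesMap_apply_zero (F : Fin (k + 1) → A.C1) (l : ℂ) (a b : Fin (k + 1) → L) :
    (A.trunc k).brN (A.seriesMap F) l a b 0 = A.brN (F 0) l (a 0) (b 0) := by
  simp only [brN, Pi.add_apply, Pi.sub_apply, ev_trunc_br_apply_zero, seriesMap_apply_zero]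

theorem ev_trunc_br_single_zero_left (l : ℂ) (x : L) (b : Fin (k + 1) → L) :
    ev l ((A.trunc k).br (Pi.single 0 x) b) = fun i => ev l (A.br x (b i)) := by
  funext s
  rw [ev_trunc_br_apply, sum_expPairs_of_fst_eq_zero]
  · simp
  · intro x hx
    simp [hx]

theorem ev_trunc_br_single_zero_right (l : ℂ) (a : Fin (k + 1) → L) (y : L) :
    ev l ((A.trunc k).br a (Pi.single 0 y)) = fun i => ev l (A.br (a i) y) := by
  funext s
  rw [ev_trunc_br_apply, sum_expPairs_swap, sum_expPairs_of_fst_eq_zero]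
  · simp
  · intro x hx
    simp [hx]

theorem ev_trunc_br_single_zero_single_zero (l : ℂ) (x y : L) :
    ev l ((A.trunc k).br (Pi.single 0 x) (Pi.single 0 y)) = Pi.single 0 (ev l (A.br x y)) := by
  rw [ev_trunc_br_single_zero_left]
  funext i
  exact Pi.apply_single (fun _ z => ev l (A.br x z)) (by simp) 0 y i

theorem seriesMap_single_zero (F : Fin (k + 1) → A.C1) (x : L) :
    (A.seriesMap F).1 (Pi.single 0 x) = fun i => (F i).1 x := by
  funext s
  rw [seriesMap_apply, sum_expPairs_swap, sum_expPairs_of_fst_eq_zero]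
  · simp
  · intro x hx
    simp [hx]

theorem ev_trunc_br_single_last_right (l : ℂ) (a : Fin (k + 1) → L) (y : L) :
    ev l ((A.trunc k).br a (Pi.single (Fin.last k) y)) =
      Pi.single (Fin.last k) (ev l (A.br (a 0) y)) := by
  funext s
  rw [ev_trunc_br_apply, sum_expPairs_of_snd_eq_last]
  · simp
  · intro x hx
    simp [hx]

theorem ev_trunc_br_single_last_left (l : ℂ) (x : L) (b : Fin (k + 1) → L) :
    ev l ((A.trunc k).br (Pi.single (Fin.last k) x) b) =
      Pi.single (Fin.last k) (ev l (A.br x (b 0))) := by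
  funext s
  rw [ev_trunc_br_apply, sum_expPairs_swap, sum_expPairs_of_snd_eq_last]
  · simp
  · intro x hx
    simp [hx]

theorem seriesMap_single_last (F : Fin (k + 1) → A.C1) (x : L) :
    (A.seriesMap F).1 (Pi.single (Fin.last k) x) = Pi.single (Fin.last k) ((F 0).1 x) := by
  funext s
  rw [seriesMap_apply, sum_expPairs_of_snd_eq_last]
  · simp
  · intro x hx
    simp [hx]

theorem d2_seriesMap_eq_single_last (F : Fin (k + 1) → A.C1) {f : (A.trunc k).C2} {g : A.C2}
    (hfg : ∀ l a b, ev l (f.val a b) = Pi.single (Fin.last k) (ev l (g.val (a 0) (b 0))))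
    (l m : ℂ) (a b c : Fin (k + 1) → L) :
    (A.trunc k).d2 (A.seriesMap F) f l m a b c =
      Pi.single (Fin.last k) (A.d2 (F 0) g l m (a 0) (b 0) (c 0)) := by
  simp only [d2_apply, hfg, ev_trunc_br_single_last_left, ev_trunc_br_single_last_right,
    ev_trunc_br_apply_zero, seriesMap_apply_zero, brN_seriesMap_apply_zero, map_add, map_sub,
    seriesMap_single_last, Pi.single_add, Pi.single_sub]

/-- Multiplication by `t`, as a map from `L[[t]]/t^{k+1}` to `L[[t]]/t^{k+2}`. -/
def mulT (k : ℕ) : (Fin (k + 1) → L) →ₗ[ℂ] (Fin (k + 2) → L) where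
  toFun a := Fin.cons 0 a
  map_add' a b := by
    funext i
    refine Fin.cases ?_ (fun _ => ?_) i <;> simp
  map_smul' c a := by
    funext i
    refine Fin.cases ?_ (fun _ => ?_) i <;> simp

theorem mulT_apply_zero (a : Fin (k + 1) → L) : mulT k a 0 = 0 := rfl

theorem mulT_apply_succ (a : Fin (k + 1) → L) (i : Fin (k + 1)) : mulT k a i.succ = a i := rfl

theorem single_zero_add_mulT_tail (a : Fin (k + 2) → L) :
    Pi.single 0 (a 0) + mulT k (Fin.tail a) = a := by
  funext i
  refine Fin.cases ?_ (fun i => ?_) i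
  · simp [mulT_apply_zero]
  · simp [mulT_apply_succ, Fin.tail]

theorem eq_mulT {a : Fin (k + 2) → L} {b : Fin (k + 1) → L} (h0 : a 0 = 0)
    (hsucc : ∀ i : Fin (k + 1), a i.succ = b i) : a = mulT k b :=
  funext fun i => Fin.cases h0 hsucc i

theorem ev_trunc_br_mulT (l : ℂ) (a : Fin (k + 1) → L) (b : Fin (k + 2) → L) :
    ev l ((A.trunc (k + 1)).br (mulT k a) b) = mulT k (ev l ((A.trunc k).br a (Fin.init b))) := by
  refine eq_mulT ?_ fun s => ?_
  · simp [ev_trunc_br_apply_zero, mulT_apply_zero]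
  · rw [ev_trunc_br_apply, sum_expPairs_succ, ev_trunc_br_apply]
    simp [mulT_apply_zero, mulT_apply_succ, Fin.init]

theorem seriesMap_mulT (F : Fin (k + 2) → A.C1) (a : Fin (k + 1) → L) :
    (A.seriesMap F).1 (mulT k a) = mulT k ((A.seriesMap (k := k) (Fin.init F)).1 a) := by
  refine eq_mulT ?_ fun s => ?_
  · simp [seriesMap_apply_zero, mulT_apply_zero]
  · rw [seriesMap_apply, sum_expPairs_swap, sum_expPairs_succ, seriesMap_apply, sum_expPairs_swap]
    simp [mulT_apply_zero, mulT_apply_succ, Fin.init]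

theorem init_seriesMap (F : Fin (k + 2) → A.C1) (a : Fin (k + 2) → L) :
    Fin.init ((A.seriesMap F).1 a) = (A.seriesMap (k := k) (Fin.init F)).1 (Fin.init a) := by
  funext s
  rw [Fin.init, seriesMap_apply, sum_expPairs_castSucc, seriesMap_apply]
  rfl

theorem torsion_seriesMap_mulT (F : Fin (k + 2) → A.C1) (l : ℂ) (a : Fin (k + 1) → L)
    (b : Fin (k + 2) → L) :
    (A.trunc (k + 1)).torsion (A.seriesMap F) (A.seriesMap F) l (mulT k a) b =
      mulT k ((A.trunc k).torsion (A.seriesMap (Fin.init F)) (A.seriesMap (Fin.init F)) l a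
        (Fin.init b)) := by
  simp only [torsion, seriesMap_mulT, ev_trunc_br_mulT, init_seriesMap, map_add, map_sub]

theorem torsion_seriesMap_single_zero (F : Fin (k + 1) → A.C1) (l : ℂ) (x y : L)
    (s : Fin (k + 1)) :
    (A.trunc k).torsion (A.seriesMap F) (A.seriesMap F) l (Pi.single 0 x) (Pi.single 0 y) s =
      ∑ z ∈ expPairs k s, A.torsion (F z.1) (F z.2) l x y := by
  simp only [torsion, Pi.add_apply, Pi.sub_apply, seriesMap_single_zero,
    ev_trunc_br_single_zero_single_zero]
  simp only [ev_trunc_br_single_zero_left, ev_trunc_br_single_zero_right, seriesMap_apply,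
    ev_trunc_br_apply, sum_add_distrib, sum_sub_distrib]

/-- The coefficient of `t^s` in `[∑ F_i t^i, ∑ F_i t^i]`, for a polynomial `∑ F_i t^i` of degree
at most `k`. As `s` may exceed `k`, this is the square of a polynomial and not of a truncated
series. -/
def fnCoeff (F : Fin (k + 1) → A.C1) (s : ℕ) : A.C2 :=
  ∑ x ∈ expPairs k s, A.fn (F x.1) (F x.2)

theorem fnCoeff_init (F : Fin (k + 2) → A.C1) (s : Fin (k + 1)) :
    A.fnCoeff (k := k) (Fin.init F) s = A.fnCoeff F s.castSucc := by
  rw [fnCoeff, fnCoeff, sum_expPairs_castSucc]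
  rfl

theorem fnCoeff_last (F : Fin (k + 2) → A.C1) :
    A.fnCoeff F (k + 1) =
      A.fnCoeff (k := k) (Fin.init F) (k + 1) + (2 : ℂ) • A.d1 (F 0) (F (Fin.last (k + 1))) := by
  rw [fnCoeff, sum_expPairs_last, A.fn_comm (F (Fin.last (k + 1))), add_assoc, two_smul]
  rfl

theorem ev_fnCoeff (F : Fin (k + 1) → A.C1) (s : ℕ) (l : ℂ) (p q : L) :
    ev l ((A.fnCoeff F s).val p q) =
      (2 : ℂ) • ∑ x ∈ expPairs k s, A.torsion (F x.1) (F x.2) l p q := by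
  rw [fnCoeff, C2.val_sum, LinearMap.sum_apply, LinearMap.sum_apply, map_sum, two_smul]
  simp only [ev_fn, sum_add_distrib]
  congr 1
  exact (sum_expPairs_swap s fun x => A.torsion (F x.1) (F x.2) l p q).symm

theorem ev_fn_seriesMap_self_single_zero (F : Fin (k + 1) → A.C1) (l : ℂ) (x y : L)
    (s : Fin (k + 1)) :
    ev l (((A.trunc k).fn (A.seriesMap F) (A.seriesMap F)).val (Pi.single 0 x) (Pi.single 0 y)) s =
      ev l ((A.fnCoeff F s).val x y) := by
  rw [ev_fn_self, Pi.smul_apply, torsion_seriesMap_single_zero, ev_fnCoeff]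

variable {A} in
theorem IsNijenhuis.fnCoeff_eq_zero {F : Fin (k + 1) → A.C1}
    (h : (A.trunc k).IsNijenhuis (A.seriesMap F)) (s : Fin (k + 1)) : A.fnCoeff F s = 0 := by
  refine C2.ext_ev fun l p q => ?_
  rw [← ev_fn_seriesMap_self_single_zero, (isNijenhuis_iff_fn_self_eq_zero _ _).mp h]
  exact (congrFun (map_zero (ev l)) s).trans (map_zero (ev l)).symm

section Lift

variable {A} {F : Fin (k + 2) → A.C1}

theorem ev_fn_seriesMap_self
    (h : (A.trunc k).IsNijenhuis (A.seriesMap (k := k) (Fin.init F)))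
    (l : ℂ) (a b : Fin (k + 2) → L) :
    ev l (((A.trunc (k + 1)).fn (A.seriesMap F) (A.seriesMap F)).val a b) =
      Pi.single (Fin.last (k + 1)) (ev l ((A.fnCoeff F (k + 1)).val (a 0) (b 0))) := by
  set f := (A.trunc (k + 1)).fn (A.seriesMap F) (A.seriesMap F) with hf
  have hleft (l : ℂ) (a : Fin (k + 1) → L) (b : Fin (k + 2) → L) :
      ev l (f.val (mulT k a) b) = 0 := by
    rw [hf, ev_fn_self, torsion_seriesMap_mulT, (isNijenhuis_iff_torsion_eq_zero _ _).mp h,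
      map_zero, smul_zero]
  have hright (l : ℂ) (a : Fin (k + 2) → L) (b : Fin (k + 1) → L) :
      ev l (f.val a (mulT k b)) = 0 :=
    f.val_apply_eq_zero_comm (fun l a => hleft l b a) l a
  have hconst : ev l (f.val a b) = ev l (f.val (Pi.single 0 (a 0)) (Pi.single 0 (b 0))) := by
    conv_lhs => rw [← single_zero_add_mulT_tail a, ← single_zero_add_mulT_tail b]
    simp only [map_add, LinearMap.add_apply, hleft, hright, add_zero]
  rw [hconst]
  funext s
  rw [hf, ev_fn_seriesMap_self_single_zero]
  induction s using Fin.lastCases with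
  | last => rw [Pi.single_eq_same, Fin.val_last]
  | cast s =>
    rw [Pi.single_eq_of_ne (Fin.castSucc_ne_last s), ← fnCoeff_init, h.fnCoeff_eq_zero]
    exact map_zero (ev l)

theorem isNijenhuis_seriesMap_iff_fnCoeff_eq_zero
    (h : (A.trunc k).IsNijenhuis (A.seriesMap (k := k) (Fin.init F))) :
    (A.trunc (k + 1)).IsNijenhuis (A.seriesMap F) ↔ A.fnCoeff F (k + 1) = 0 := by
  refine ⟨fun hF => hF.fnCoeff_eq_zero (Fin.last (k + 1)), fun hF => ?_⟩
  refine (isNijenhuis_iff_fn_self_eq_zero _ _).mpr (C2.ext_ev fun l a b => ?_)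
  rw [ev_fn_seriesMap_self h, hF]
  exact Pi.single_zero _

theorem d2_fnCoeff_eq_zero
    (h : (A.trunc k).IsNijenhuis (A.seriesMap (k := k) (Fin.init F))) :
    A.d2 (F 0) (A.fnCoeff F (k + 1)) = 0 := by
  funext l m p q r
  have hsingle := A.d2_seriesMap_eq_single_last F (ev_fn_seriesMap_self h) l m
    (Pi.single 0 p) (Pi.single 0 q) (Pi.single 0 r)
  rw [d2_fn_self] at hsingle
  simpa using (congrFun hsingle (Fin.last (k + 1))).symm

end Lift

end Truncation

variable {A}

theorem H2.mk_eq_zero_iff {N : A.C1} {f : A.C2} (hf : f ∈ A.Z2 N) :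
    H2.mk A N f hf = 0 ↔ f ∈ A.B2 N := by
  rw [H2.mk, Submodule.Quotient.mk_eq_zero, Submodule.submoduleOf, Submodule.mem_comap]
  rfl

namespace Deformation

variable {N : A.C1} {n : ℕ} (T : A.Deformation N n)

theorem obstruction_eq : T.obstruction = (-(1 / 2) : ℂ) • A.fnCoeff T.coeff (n + 1) := by
  rw [obstruction, fnCoeff, filter_true_of_mem]
  intro x hx
  have hsum := mem_expPairs.mp hx
  omega

theorem fnCoeff_eq_two_smul {F : Fin (n + 2) → A.C1} (hF : Fin.init F = T.coeff) :
    A.fnCoeff F (n + 1) = (2 : ℂ) • (A.d1 N (F (Fin.last (n + 1))) - T.obstruction) := by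
  have h0 : F 0 = N := (congrFun hF 0).trans T.coeff_zero
  rw [fnCoeff_last, hF, h0, obstruction_eq]
  module

theorem obstruction_mem_Z2 : T.obstruction ∈ A.Z2 N := by
  let F : Fin (n + 2) → A.C1 := Fin.snoc (α := fun _ => A.C1) T.coeff 0
  have hF : Fin.init F = T.coeff := Fin.init_snoc _ _
  have h0 : F 0 = N := (congrFun hF 0).trans T.coeff_zero
  have hlast : F (Fin.last (n + 1)) = 0 := Fin.snoc_last _ _
  have hd2 := d2_fnCoeff_eq_zero (F := F) (hF ▸ T.isNijenhuis)
  rw [h0, T.fnCoeff_eq_two_smul hF, hlast, map_zero, zero_sub, smul_neg, map_neg, map_smul,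
    neg_eq_zero] at hd2
  exact (smul_eq_zero.mp hd2).resolve_left two_ne_zero

theorem isNijenhuis_iff_d1_eq_obstruction {F : Fin (n + 2) → A.C1} (hF : Fin.init F = T.coeff) :
    (A.trunc (n + 1)).IsNijenhuis (A.seriesMap F) ↔
      A.d1 N (F (Fin.last (n + 1))) = T.obstruction := by
  rw [isNijenhuis_seriesMap_iff_fnCoeff_eq_zero (hF ▸ T.isNijenhuis), T.fnCoeff_eq_two_smul hF,
    smul_eq_zero_iff_right two_ne_zero, sub_eq_zero]

theorem extensible_iff_obstruction_mem_B2 : T.Extensible ↔ T.obstruction ∈ A.B2 N := by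
  constructor
  · rintro ⟨T', hT'⟩
    exact ⟨_, (T.isNijenhuis_iff_d1_eq_obstruction (funext hT')).mp T'.isNijenhuis⟩
  · rintro ⟨M, hM⟩
    let F : Fin (n + 2) → A.C1 := Fin.snoc (α := fun _ => A.C1) T.coeff M
    have hF : Fin.init F = T.coeff := Fin.init_snoc _ _
    have hlast : F (Fin.last (n + 1)) = M := Fin.snoc_last _ _
    have hNijenhuis : (A.trunc (n + 1)).IsNijenhuis (A.seriesMap F) :=
      (T.isNijenhuis_iff_d1_eq_obstruction hF).mpr (hlast.symm ▸ hM)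
    exact ⟨⟨F, (congrFun hF 0).trans T.coeff_zero, hNijenhuis⟩, congrFun hF⟩

end Deformation

end LieConformalAlgebra

end LieConformal

end

theorem mainTheorem7 {L : Type*} [AddCommGroup L] [Module ℂ L]
    (A : LieConformal.LieConformalAlgebra L) (N : A.C1) (hN : A.IsNijenhuis N) :
    (∀ (n : ℕ) (T : A.Deformation N n),
      ∃ hT : T.obstruction ∈ A.Z2 N,
        (T.Extensible ↔
          LieConformal.LieConformalAlgebra.H2.mk A N T.obstruction hT = 0)) ∧
    (Subsingleton (A.H2 N) → ∀ (n : ℕ) (T : A.Deformation N n), T.Extensible) := by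
  have extensible_iff (n : ℕ) (T : A.Deformation N n) :
      T.Extensible ↔
        LieConformal.LieConformalAlgebra.H2.mk A N T.obstruction T.obstruction_mem_Z2 = 0 :=
    T.extensible_iff_obstruction_mem_B2.trans <|
      (LieConformal.LieConformalAlgebra.H2.mk_eq_zero_iff T.obstruction_mem_Z2).symm
  exact ⟨fun n T => ⟨T.obstruction_mem_Z2, extensible_iff n T⟩,
    fun _ n T => (extensible_iff n T).mpr (Subsingleton.elim _ _)⟩
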